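/- Let $G$ be a finite simple graph. Write $\mathcal A(G)$ for its set of arcs (each edge $uv$ gives the arcs $(u,v)$ and $(v,u)$); an arc $e=(u,v)$ has origin $o(e)=u$, terminus $t(e)=v$ and inverse $e^{-1}=(v,u)$. The Grover transfer matrix $U=U(G)$, indexed by $\mathcal A(G)$, is given by \[ U_{e,f}=\begin{cases}2/\deg(t(f)) & \text{if } t(f)=o(e),\ e\neq f^{-1},\\ 2/\deg(t(f))-1 & \text{if } e=f^{-1},\\ 0 & \text{otherwise.}\end{cases} \] The Grover walk on $G$ is called periodic if there is an integer $k\ge 1$ with $U^k=I$ (the least such $k$ is its period). The graph $G$ is called distance-regular if it is connected and regular and, for all vertices $x,y$ at distance $j$, the numbers of neighbours of $y$ at distance $j-1$, $j$ and $j+1$ from $x$ depend only on $j$. Theorem. A finite simple graph is a distance-regular graph of diameter $2$ whose Grover walk is periodic if and only if it is isomorphic to the cycle $C_5$, to the complete bipartite graph $K_{k,k}$ for some integer $k\ge 2$, or to the complete tripartite graph $K_{m,m,m}$ for some integer $m\ge 2$. -/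

import Mathlib

namespace SimpleGraph

/-- A finite simple graph `G` is distance-regular if it is connected, regular, and for `y` at
distance `j` from `x` the numbers of neighbours of `y` at distance `j - 1`, `j` and `j + 1` from `x`
(the intersection numbers `c j`, `a j`, `b j`) depend only on `j`. -/
structure IsDistanceRegular {V : Type*} [Fintype V] (G : SimpleGraph V)
    [DecidableRel G.Adj] : Prop where
  connected : G.Connected
  regular : ∃ k : ℕ, G.IsRegularOfDegree k
  intersection : ∃ c a b : ℕ → ℕ, ∀ (j : ℕ) (x y : V), G.dist x y = j →
    ((G.neighborFinset y).filter fun z => G.dist x z + 1 = j).card = c j ∧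
    ((G.neighborFinset y).filter fun z => G.dist x z = j).card = a j ∧
    ((G.neighborFinset y).filter fun z => G.dist x z = j + 1).card = b j

/-- The Grover transfer matrix, indexed by the arcs (darts) of `G`. An arc `e` has origin `e.fst`,
terminus `e.snd` and inverse arc `e.symm`. -/
noncomputable def groverMatrix {V : Type*} [Fintype V] [DecidableEq V] (G : SimpleGraph V)
    [DecidableRel G.Adj] : Matrix G.Dart G.Dart ℂ :=
  Matrix.of fun e f =>
    if f.snd = e.fst ∧ e ≠ f.symm then 2 / (G.degree f.snd : ℂ)
    else if e = f.symm then 2 / (G.degree f.snd : ℂ) - 1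
    else 0

/-- The Grover walk on `G` is `k`-periodic: `k` is the least positive integer such that the `k`-th
power of the Grover transfer matrix is the identity. -/
def IsGroverPeriodicWith {V : Type*} [Fintype V] [DecidableEq V] (G : SimpleGraph V)
    [DecidableRel G.Adj] (k : ℕ) : Prop :=
  0 < k ∧ G.groverMatrix ^ k = 1 ∧ ∀ j : ℕ, 0 < j → j < k → G.groverMatrix ^ j ≠ 1

/-- `G` induces a periodic Grover walk. -/
def IsGroverPeriodic {V : Type*} [Fintype V] [DecidableEq V] (G : SimpleGraph V)
    [DecidableRel G.Adj] : Prop :=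
  ∃ k : ℕ, G.IsGroverPeriodicWith k

end SimpleGraph

/-! Let `A` be the adjacency matrix of a `k`-regular graph, `k ≠ 0`, and `U` its Grover matrix. On
the arc space spanned by the columns of `terminusMatrix` and their images under `U`, the operator `U
+ U⁻¹` acts as `2A/k`, and `U ^ 2 - 1` has its range in that space. So an eigenvalue `r` of `A`
yields eigenvalues `z` of `U` with `z + z⁻¹ = 2r/k`, and all other eigenvalues of `U` are `±1`.

If `U ^ p = 1`, every such `z` is a root of unity, so each `2r/k` is an algebraic integer.
Distance-regular of diameter 2 means strongly regular with parameters `(n, k, ℓ, μ)`, where the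
eigenvalues `r`, `s` other than `k` satisfy `r + s = ℓ - μ` and `rs = μ - k`. Hence `2(ℓ - μ)/k` and
`4(k - μ)/k²` are integers, which leaves only `(k, ℓ, μ) = (2, 0, 1)`, `μ = k` with `ℓ = 0`, or `μ =
k = 2ℓ` (`IsSRGWith.params_of_groverMatrix_pow_eq_one`). These are `C₅`, `K_{k,k}` and `K_{m,m,m}`
(`IsSRGWith.classification`).

Conversely, the cubic equation of `A` gives a polynomial annihilating `U` that divides a power of `X
^ p - 1`. Since `U` is unitary, `U ^ p - 1` is normal and nilpotent, hence zero; `p` is 10, 4 and 12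
respectively. -/

namespace SimpleGraph

open Matrix

set_option linter.unusedSectionVars false

variable {V : Type*} [Fintype V] [DecidableEq V] (G : SimpleGraph V) [DecidableRel G.Adj]

/-! ### Incidence matrices of arcs and the algebra of the Grover matrix -/

/-- The incidence matrix between arcs and their termini. -/
noncomputable def terminusMatrix : Matrix G.Dart V ℂ :=
  Matrix.of fun e v => if e.snd = v then 1 else 0

/-- The incidence matrix between arcs and their origins. -/
noncomputable def originMatrix : Matrix G.Dart V ℂ :=
  Matrix.of fun e v => if e.fst = v then 1 else 0

/-- The permutation matrix of the inversion of arcs. -/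
noncomputable def flipMatrix : Matrix G.Dart G.Dart ℂ :=
  Matrix.of fun e f => if e = f.symm then 1 else 0

theorem flipMatrix_mul_terminusMatrix : G.flipMatrix * G.terminusMatrix = G.originMatrix := by
  ext e v
  simp only [mul_apply, flipMatrix, terminusMatrix, originMatrix, of_apply]
  rw [Finset.sum_eq_single e.symm]
  · simp
  · intro f _ hf
    rw [if_neg, zero_mul]
    rintro rfl
    simp at hf
  · simp

theorem flipMatrix_mul_originMatrix : G.flipMatrix * G.originMatrix = G.terminusMatrix := by
  ext e v
  simp only [mul_apply, flipMatrix, terminusMatrix, originMatrix, of_apply]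
  rw [Finset.sum_eq_single e.symm]
  · simp
  · intro f _ hf
    rw [if_neg, zero_mul]
    rintro rfl
    simp at hf
  · simp

theorem flipMatrix_mul_self : G.flipMatrix * G.flipMatrix = 1 := by
  ext e v
  simp only [mul_apply, flipMatrix, of_apply, one_apply]
  rw [Finset.sum_eq_single e.symm]
  · simp [SimpleGraph.Dart.symm_involutive.injective.eq_iff]
  · intro f _ hf
    rw [if_neg, zero_mul]
    rintro rfl
    simp at hf
  · simp

theorem conjTranspose_flipMatrix : G.flipMatrixᴴ = G.flipMatrix := by
  ext e f
  simp only [conjTranspose_apply, flipMatrix, of_apply]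
  have : f = e.symm ↔ e = f.symm := by
    constructor <;> rintro rfl <;> simp
  simp only [this]
  split_ifs <;> simp

theorem conjTranspose_terminusMatrix : G.terminusMatrixᴴ = G.terminusMatrixᵀ := by
  ext e f
  simp only [conjTranspose_apply, transpose_apply, terminusMatrix, of_apply]
  split_ifs <;> simp

theorem conjTranspose_originMatrix : G.originMatrixᴴ = G.originMatrixᵀ := by
  ext e f
  simp only [conjTranspose_apply, transpose_apply, originMatrix, of_apply]
  split_ifs <;> simp

theorem transpose_flipMatrix : G.flipMatrixᵀ = G.flipMatrix := by
  ext e f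
  simp only [transpose_apply, flipMatrix, of_apply]
  have : f = e.symm ↔ e = f.symm := by
    constructor <;> rintro rfl <;> simp
  simp only [this]

theorem transpose_originMatrix_mul_originMatrix {k : ℕ} (h : G.IsRegularOfDegree k) :
    G.originMatrixᵀ * G.originMatrix = (k : ℂ) • 1 := by
  ext u v
  simp only [mul_apply, transpose_apply, originMatrix, of_apply, Matrix.smul_apply, one_apply, smul_eq_mul]
  by_cases huv : u = v
  · subst huv
    have := G.dart_fst_fiber_card_eq_degree u
    rw [h u] at this
    rw [← this]
    simp [← ite_and]
  · rw [if_neg huv, mul_zero]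
    refine Finset.sum_eq_zero fun e _ => ?_
    split_ifs with h1 h2 <;> simp_all

theorem transpose_originMatrix_mul_terminusMatrix :
    G.originMatrixᵀ * G.terminusMatrix = G.adjMatrix ℂ := by
  ext u v
  simp only [mul_apply, transpose_apply, originMatrix, terminusMatrix, of_apply, adjMatrix_apply]
  by_cases huv : G.Adj u v
  · rw [if_pos huv, Finset.sum_eq_single (⟨(u, v), huv⟩ : G.Dart)]
    · simp
    · intro f _ hf
      by_cases h1 : f.fst = u <;> by_cases h2 : f.snd = v <;> simp [h1, h2]
      exact hf (Dart.ext _ _ (Prod.ext h1 h2))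
    · simp
  · rw [if_neg huv]
    refine Finset.sum_eq_zero fun e _ => ?_
    by_cases h1 : e.fst = u <;> by_cases h2 : e.snd = v <;> simp [h1, h2]
    exact huv (h1 ▸ h2 ▸ e.adj)

theorem transpose_terminusMatrix_mul_terminusMatrix {k : ℕ} (h : G.IsRegularOfDegree k) :
    G.terminusMatrixᵀ * G.terminusMatrix = (k : ℂ) • 1 := by
  rw [← flipMatrix_mul_originMatrix, transpose_mul, transpose_flipMatrix, Matrix.mul_assoc,
    ← Matrix.mul_assoc G.flipMatrix, flipMatrix_mul_self, Matrix.one_mul,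
    transpose_originMatrix_mul_originMatrix G h]

theorem transpose_terminusMatrix_mul_originMatrix :
    G.terminusMatrixᵀ * G.originMatrix = G.adjMatrix ℂ := by
  rw [← flipMatrix_mul_originMatrix, transpose_mul, transpose_flipMatrix, Matrix.mul_assoc,
    flipMatrix_mul_originMatrix, transpose_originMatrix_mul_terminusMatrix]

theorem transpose_terminusMatrix_mul_flipMatrix :
    G.terminusMatrixᵀ * G.flipMatrix = G.originMatrixᵀ := by
  rw [← flipMatrix_mul_terminusMatrix, transpose_mul, transpose_flipMatrix]

variable {G} {k : ℕ}

/-- The condition `e = f.symm` forces `f.snd = e.fst`, so the two nonzero cases of `groverMatrix`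
differ only by the `-1` that `flipMatrix` supplies. -/
theorem IsRegularOfDegree.groverMatrix_eq (h : G.IsRegularOfDegree k) :
    G.groverMatrix = (2 / k : ℂ) • (G.originMatrix * G.terminusMatrixᵀ) - G.flipMatrix := by
  ext e f
  simp only [groverMatrix, of_apply, Matrix.sub_apply, Matrix.smul_apply, mul_apply, originMatrix,
    terminusMatrix, flipMatrix, transpose_apply, h.degree_eq, smul_eq_mul]
  have hs : ∑ x, ((if e.fst = x then (1 : ℂ) else 0) * if f.snd = x then 1 else 0) =
      if f.snd = e.fst then 1 else 0 := by simp [eq_comm]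
  rw [hs]
  by_cases h1 : e = f.symm
  · subst h1; simp
  · simp [h1]

theorem IsRegularOfDegree.groverMatrix_mul_terminusMatrix (h : G.IsRegularOfDegree k)
    (hk : k ≠ 0) : G.groverMatrix * G.terminusMatrix = G.originMatrix := by
  have hk' : (k : ℂ) ≠ 0 := Nat.cast_ne_zero.2 hk
  rw [h.groverMatrix_eq, Matrix.sub_mul, Matrix.smul_mul, Matrix.mul_assoc,
    transpose_terminusMatrix_mul_terminusMatrix G h, flipMatrix_mul_terminusMatrix, Matrix.mul_smul,
    Matrix.mul_one, smul_smul, div_mul_cancel₀ _ hk']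
  module

theorem IsRegularOfDegree.groverMatrix_mul_originMatrix (h : G.IsRegularOfDegree k) :
    G.groverMatrix * G.originMatrix =
      (2 / k : ℂ) • (G.originMatrix * G.adjMatrix ℂ) - G.terminusMatrix := by
  rw [h.groverMatrix_eq, Matrix.sub_mul, Matrix.smul_mul, Matrix.mul_assoc,
    transpose_terminusMatrix_mul_originMatrix, flipMatrix_mul_originMatrix]

/-- The Grover matrix and its inverse add up to twice the transition matrix on the span of the
termini. -/
theorem IsRegularOfDegree.groverMatrix_sq_add_one_mul (h : G.IsRegularOfDegree k) (hk : k ≠ 0) :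
    (G.groverMatrix ^ 2 + 1) * G.terminusMatrix =
      G.groverMatrix * G.terminusMatrix * ((2 / k : ℂ) • G.adjMatrix ℂ) := by
  rw [Matrix.add_mul, pow_two, Matrix.mul_assoc, h.groverMatrix_mul_terminusMatrix hk,
    h.groverMatrix_mul_originMatrix, Matrix.one_mul, Matrix.mul_smul]
  abel

/-- Shows that the range of `U ^ 2 - 1` lies in the span of the columns of `U * T` and `U * (U *
T)`, with `T` the terminus matrix. A polynomial in `U` that kills `T` therefore kills everything
after multiplication by `U ^ 2 - 1`. -/
theorem IsRegularOfDegree.groverMatrix_sq_sub_one (h : G.IsRegularOfDegree k) (hk : k ≠ 0) :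
    G.groverMatrix ^ 2 - 1 =
      (2 / k : ℂ) • (G.groverMatrix * (G.groverMatrix * G.terminusMatrix) * G.terminusMatrixᵀ
        - G.groverMatrix * G.terminusMatrix * G.originMatrixᵀ) := by
  have h1 : G.groverMatrix * G.flipMatrix =
      (2 / k : ℂ) • (G.originMatrix * G.originMatrixᵀ) - 1 := by
    rw [h.groverMatrix_eq, Matrix.sub_mul, Matrix.smul_mul, Matrix.mul_assoc,
      transpose_terminusMatrix_mul_flipMatrix, flipMatrix_mul_self]
  rw [h.groverMatrix_mul_terminusMatrix hk, pow_two]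
  nth_rw 2 [h.groverMatrix_eq]
  rw [Matrix.mul_sub, h1, Matrix.mul_smul, Matrix.mul_assoc, smul_sub]
  abel

theorem IsRegularOfDegree.conjTranspose_groverMatrix_mul_self (h : G.IsRegularOfDegree k)
    (hk : k ≠ 0) : G.groverMatrixᴴ * G.groverMatrix = 1 := by
  have h1 : G.groverMatrixᴴ =
      (2 / k : ℂ) • (G.terminusMatrix * G.originMatrixᵀ) - G.flipMatrix := by
    rw [h.groverMatrix_eq, conjTranspose_sub, conjTranspose_smul, conjTranspose_mul,
      conjTranspose_flipMatrix, conjTranspose_originMatrix,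
      ← conjTranspose_terminusMatrix, conjTranspose_conjTranspose]
    simp
  have hk' : (k : ℂ) ≠ 0 := Nat.cast_ne_zero.2 hk
  have h2 : G.originMatrixᵀ * G.flipMatrix = G.terminusMatrixᵀ := by
    rw [← flipMatrix_mul_originMatrix, transpose_mul, transpose_flipMatrix]
  rw [h1]
  nth_rw 1 [h.groverMatrix_eq]
  rw [Matrix.sub_mul, Matrix.mul_sub, Matrix.mul_sub, Matrix.smul_mul, Matrix.smul_mul, Matrix.mul_smul, Matrix.mul_smul,
    Matrix.mul_assoc, ← Matrix.mul_assoc G.originMatrixᵀ,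
    transpose_originMatrix_mul_originMatrix G h, Matrix.smul_mul, Matrix.one_mul, Matrix.mul_smul,
    Matrix.mul_assoc, h2, ← Matrix.mul_assoc, flipMatrix_mul_originMatrix, flipMatrix_mul_self,
    smul_smul, smul_smul, mul_assoc (2 / k : ℂ), div_mul_cancel₀ _ hk']
  module

end SimpleGraph

/-! ### Periodicity forces `2r/k` to be an algebraic integer -/

namespace SimpleGraph

open Matrix Polynomial

set_option linter.unusedSectionVars false

variable {V : Type*} [Fintype V] [DecidableEq V] {G : SimpleGraph V} [DecidableRel G.Adj] {k : ℕ}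

theorem isGroverPeriodic_iff_exists_pow_eq_one :
    G.IsGroverPeriodic ↔ ∃ p : ℕ, 0 < p ∧ G.groverMatrix ^ p = 1 := by
  classical
  constructor
  · rintro ⟨p, hp, h, -⟩
    exact ⟨p, hp, h⟩
  · intro h
    refine ⟨Nat.find h, (Nat.find_spec h).1, (Nat.find_spec h).2, fun j hj hlt hU => ?_⟩
    exact Nat.find_min h hlt ⟨hj, hU⟩

/-- The eigenvalues of the transition matrix of a periodic Grover walk are halves of algebraic
integers. -/
theorem IsRegularOfDegree.isIntegral_of_groverMatrix_pow_eq_one (h : G.IsRegularOfDegree k)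
    (hk : k ≠ 0) {p : ℕ} (hp : 0 < p) (hU : G.groverMatrix ^ p = 1) {W : Matrix V V ℂ} {r : ℂ}
    (hW : W ≠ 0) (hr : G.adjMatrix ℂ * W = r • W) : IsIntegral ℤ (2 * r / k) := by
  set x : ℂ := 2 * r / k with hx
  obtain ⟨z, hz⟩ : ∃ z : ℂ, z * z - x * z + 1 = 0 := by
    obtain ⟨s, hs⟩ := IsAlgClosed.exists_pow_nat_eq (x ^ 2 - 4) two_pos
    exact ⟨(x + s) / 2, by linear_combination (1 / 4 : ℂ) * hs⟩
  have hz0 : z ≠ 0 := by rintro rfl; simp at hz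
  have hxz : x = z + z⁻¹ := by field_simp; linear_combination -hz
  set U := G.groverMatrix
  have hk' : (k : ℂ) ≠ 0 := Nat.cast_ne_zero.2 hk
  set u := G.terminusMatrix * W
  have hu : u ≠ 0 := by
    intro h0
    have h1 : G.terminusMatrixᵀ * u = (k : ℂ) • W := by
      rw [← Matrix.mul_assoc, transpose_terminusMatrix_mul_terminusMatrix G h, Matrix.smul_mul,
        Matrix.one_mul]
    rw [h0, Matrix.mul_zero] at h1
    exact hW ((smul_eq_zero.1 h1.symm).resolve_left hk')
  have hrec : U * (U * u) = x • (U * u) - u := by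
    have h1 := congrArg (· * W) (h.groverMatrix_sq_add_one_mul hk)
    simp only [Matrix.add_mul, pow_two, Matrix.one_mul, Matrix.mul_assoc, Matrix.smul_mul, hr,
      Matrix.mul_smul, smul_smul] at h1
    rw [eq_sub_iff_add_eq, h1, hx]
    congr 1
    ring
  have heig : ∀ (y : ℂ) (v : Matrix G.Dart V ℂ), v ≠ 0 → U * v = y • v → y ^ p = 1 := by
    intro y v hv hy
    have h1 : ∀ n : ℕ, U ^ n * v = y ^ n • v := by
      intro n
      induction n with
      | zero => simp
      | succ n ih => rw [pow_succ', Matrix.mul_assoc, ih, Matrix.mul_smul, hy, smul_smul, pow_succ]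
    have h2 := h1 p
    rw [hU, Matrix.one_mul] at h2
    have h3 : (y ^ p - 1) • v = 0 := by rw [sub_smul, ← h2, one_smul, sub_self]
    exact sub_eq_zero.1 ((smul_eq_zero.1 h3).resolve_right hv)
  -- `hrec` says that `(U - z)(U - z⁻¹)` kills `u`. Either `u` is an eigenvector for `z⁻¹`, or `(U -
  -- z⁻¹)u` is one for `z`.
  have hzp : z ^ p = 1 := by
    by_cases hv : U * u - z⁻¹ • u = 0
    · have h1 := heig z⁻¹ u hu (sub_eq_zero.1 hv)
      rwa [inv_pow, inv_eq_one] at h1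
    · refine heig z _ hv ?_
      rw [Matrix.mul_sub, Matrix.mul_smul, hrec, hxz, smul_sub, smul_smul, mul_inv_cancel₀ hz0]
      module
  have hint : ∀ y : ℂ, y ^ p = 1 → IsIntegral ℤ y := fun y hy =>
    IsIntegral.of_pow hp (hy ▸ isIntegral_one)
  rw [hxz]
  exact (hint z hzp).add (hint z⁻¹ (by rw [inv_pow, hzp, inv_one]))

theorem exists_int_of_isIntegral_ratCast {q : ℚ} (h : IsIntegral ℤ (q : ℂ)) :
    ∃ a : ℤ, q = a := by
  have h1 : IsIntegral ℤ q :=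
    (isIntegral_algebraMap_iff (algebraMap ℚ ℂ).injective).1 (by simpa using h)
  obtain ⟨a, ha⟩ := IsIntegrallyClosed.isIntegral_iff.1 h1
  exact ⟨a, by simpa using ha.symm⟩

/-! ### Feasible parameters of strongly regular graphs -/

section StronglyRegular

variable {n ℓ μ : ℕ}

theorem IsSRGWith.adjMatrix_sq (h : G.IsSRGWith n k ℓ μ) :
    G.adjMatrix ℂ * G.adjMatrix ℂ = ((k : ℂ) - μ) • 1 + ((ℓ : ℂ) - μ) • G.adjMatrix ℂ
      + (μ : ℂ) • Matrix.of fun _ _ => 1 := by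
  have h1 := h.matrix_eq (α := ℂ)
  rw [← pow_two, h1]
  simp only [← Nat.cast_smul_eq_nsmul ℂ]
  ext x y
  by_cases hxy : x = y
  · subst hxy; simp
  · by_cases ha : G.Adj x y <;> simp [ha, hxy]

theorem IsRegularOfDegree.adjMatrix_mul_ones (h : G.IsRegularOfDegree k) :
    G.adjMatrix ℂ * Matrix.of (fun _ _ => 1) = (k : ℂ) • (Matrix.of fun _ _ => 1) := by
  ext x y
  simp [h.degree_eq]

/-- This is `(A - k)(A² - (ℓ - μ)A - (k - μ)) = 0`: the quadratic factor equals `μJ`, with `J` the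
all-ones matrix, and `AJ = kJ`. -/
theorem IsSRGWith.adjMatrix_cubic (h : G.IsSRGWith n k ℓ μ) :
    G.adjMatrix ℂ * (G.adjMatrix ℂ * G.adjMatrix ℂ) =
      ((k : ℂ) + ℓ - μ) • (G.adjMatrix ℂ * G.adjMatrix ℂ)
        + ((k : ℂ) - μ - k * (ℓ - μ)) • G.adjMatrix ℂ - ((k : ℂ) * (k - μ)) • 1 := by
  have h1 := h.regular.adjMatrix_mul_ones
  have h2 : (μ : ℂ) • (Matrix.of fun _ _ => 1 : Matrix V V ℂ) = G.adjMatrix ℂ * G.adjMatrix ℂ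
      - ((k : ℂ) - μ) • 1 - ((ℓ : ℂ) - μ) • G.adjMatrix ℂ := by
    rw [h.adjMatrix_sq]; abel
  nth_rw 1 [h.adjMatrix_sq]
  rw [Matrix.mul_add, Matrix.mul_add, Matrix.mul_smul, Matrix.mul_smul, Matrix.mul_smul, h1,
    smul_comm, h2, Matrix.mul_one]
  module

theorem IsSRGWith.isIntegral_of_groverMatrix_pow_eq_one (h : G.IsSRGWith n k ℓ μ) (hk : k ≠ 0)
    (hμ : μ ≠ 0) {x y : V} (hxy : x ≠ y) (hadj : ¬ G.Adj x y) {p : ℕ} (hp : 0 < p)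
    (hU : G.groverMatrix ^ p = 1) {r s : ℂ} (hsum : r + s = ℓ - μ) (hmul : r * s = μ - k) :
    IsIntegral ℤ (2 * r / k) := by
  -- `W = (A - k)(A - s)`, whose columns lie in the kernel of `A - r` by the cubic. Its entry at the
  -- non-adjacent pair `(x, y)` is `μ`, so it is nonzero.
  refine h.regular.isIntegral_of_groverMatrix_pow_eq_one hk hp hU
    (W := G.adjMatrix ℂ * G.adjMatrix ℂ - (s + k) • G.adjMatrix ℂ + (s * k) • 1) ?_ ?_
  · intro h0
    have h1 := congrFun (congrFun h0 x) y
    rw [h.adjMatrix_sq] at h1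
    simp [hxy, hadj, hμ] at h1
  · rw [Matrix.mul_add, Matrix.mul_sub, Matrix.mul_smul, Matrix.mul_smul, h.adjMatrix_cubic,
      Matrix.mul_one]
    have e1 : (ℓ : ℂ) - μ = r + s := hsum.symm
    have e2 : (k : ℂ) - μ = - (r * s) := by rw [hmul]; ring
    have e3 : (k : ℂ) + ℓ - μ = k + (r + s) := by rw [hsum]; ring
    rw [e3, e1, e2]
    module

/-- The parameters of a strongly regular graph with a periodic Grover walk. -/
theorem IsSRGWith.params_of_groverMatrix_pow_eq_one (h : G.IsSRGWith n k ℓ μ) (hμ : μ ≠ 0)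
    (hμk : μ ≤ k) (hℓ : ℓ + 2 ≤ k) {x y : V} (hxy : x ≠ y) (hadj : ¬ G.Adj x y) {p : ℕ}
    (hp : 0 < p) (hU : G.groverMatrix ^ p = 1) :
    (k = 2 ∧ ℓ = 0 ∧ μ = 1) ∨ (μ = k ∧ ℓ = 0) ∨ (μ = k ∧ 2 * ℓ = k) := by
  have hk : k ≠ 0 := by omega
  have hk' : (k : ℂ) ≠ 0 := Nat.cast_ne_zero.2 hk
  have hkq : (k : ℚ) ≠ 0 := Nat.cast_ne_zero.2 hk
  obtain ⟨r, s, hsum, hmul⟩ : ∃ r s : ℂ, r + s = ℓ - μ ∧ r * s = μ - k := by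
    obtain ⟨d, hd⟩ := IsAlgClosed.exists_pow_nat_eq (((ℓ : ℂ) - μ) ^ 2 - 4 * (μ - k)) two_pos
    exact ⟨(ℓ - μ + d) / 2, (ℓ - μ - d) / 2, by ring, by linear_combination (-1 / 4 : ℂ) * hd⟩
  have hr := h.isIntegral_of_groverMatrix_pow_eq_one hk hμ hxy hadj hp hU hsum hmul
  have hs := h.isIntegral_of_groverMatrix_pow_eq_one hk hμ hxy hadj hp hU
    (r := s) (s := r) (by rw [add_comm, hsum]) (by rw [mul_comm, hmul])
  -- `a` is the sum of `2r/k` and `2s/k`, and `b` is minus their product: rational algebraic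
  -- integers, hence integers.
  obtain ⟨a, ha⟩ : ∃ a : ℤ, (2 * (ℓ - μ) / k : ℚ) = a := by
    apply exists_int_of_isIntegral_ratCast
    have e : ((2 * (ℓ - μ) / k : ℚ) : ℂ) = 2 * r / k + 2 * s / k := by
      push_cast
      rw [← hsum]; ring
    rw [e]
    exact hr.add hs
  obtain ⟨b, hb⟩ : ∃ b : ℤ, (4 * (k - μ) / k ^ 2 : ℚ) = b := by
    apply exists_int_of_isIntegral_ratCast
    have e : ((4 * (k - μ) / k ^ 2 : ℚ) : ℂ) = -(2 * r / k * (2 * s / k)) := by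
      push_cast
      rw [show (k : ℂ) - μ = -(r * s) by rw [hmul]; ring]
      field_simp
      ring
    rw [e]
    exact (hr.mul hs).neg
  have ha' : 2 * ((ℓ : ℤ) - μ) = a * k := by
    rw [div_eq_iff hkq] at ha; exact_mod_cast ha
  have hb' : 4 * ((k : ℤ) - μ) = b * k ^ 2 := by
    rw [div_eq_iff (pow_ne_zero 2 hkq)] at hb; exact_mod_cast hb
  have hkpos : (0 : ℤ) < k := by positivity
  have hb0 : 0 ≤ b := by
    by_contra hneg
    have : b * (k : ℤ) ^ 2 < 0 := mul_neg_of_neg_of_pos (by omega) (by positivity)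
    omega
  -- Strict because `μ > 0`. So `b = 0`, i.e. `μ = k`, or `k < 4`.
  have hbk : b * k < 4 := by
    have : b * k * k < 4 * k := by
      calc b * k * k = 4 * ((k : ℤ) - μ) := by rw [hb']; ring
        _ < 4 * k := by omega
    exact lt_of_mul_lt_mul_right this hkpos.le
  rcases hb0.eq_or_lt with rfl | hbpos
  · right
    have hμ' : μ = k := by omega
    subst hμ'
    have h1 : a < 0 := by
      by_contra hge
      have : 0 ≤ a * (μ : ℤ) := mul_nonneg (by omega) hkpos.le
      omega
    have h2 : -3 < a := by
      by_contra hge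
      have : a * (μ : ℤ) ≤ -3 * μ := mul_le_mul_of_nonneg_right (by omega) hkpos.le
      omega
    have h3 : a = -1 ∨ a = -2 := by omega
    rcases h3 with rfl | rfl
    · right; omega
    · left; omega
  · left
    -- For `k = 3` only `b = 1` remains, and `4(3 - μ) = 9` is impossible.
    have hk4 : (k : ℤ) < 4 := by nlinarith
    have : k = 2 ∨ k = 3 := by omega
    rcases this with rfl | rfl
    · have : b = 1 := by push_cast at hbk; omega
      subst this
      push_cast at hb'
      omega
    · push_cast at hbk hb'
      omega

end StronglyRegular

/-! ### Annihilating polynomials and periodicity of the three families -/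

section Converse

open scoped ComplexOrder in
-- A nilpotent normal matrix vanishes. `H = Bᴴ * B` is Hermitian, so a vanishing `H ^ 2 ^ (m + 1)`,
-- being `(H ^ 2 ^ m)ᴴ * H ^ 2 ^ m`, makes `H ^ 2 ^ m` vanish. The descent starts at `2 ^ N`, which
-- exceeds `N`.
theorem eq_zero_of_star_mul_self_eq_zero_of_pow {ι : Type*} [Fintype ι] [DecidableEq ι]
    {B : Matrix ι ι ℂ} (hB : Commute Bᴴ B) {N : ℕ} (hN : B ^ N = 0) : B = 0 := by
  have hH : ∀ m : ℕ, (Bᴴ * B) ^ 2 ^ m = 0 → Bᴴ * B = 0 := by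
    intro m
    induction m with
    | zero => simp
    | succ m ih =>
      intro hm
      apply ih
      rw [← conjTranspose_mul_self_eq_zero, conjTranspose_pow, conjTranspose_mul,
        conjTranspose_conjTranspose, ← pow_two, ← pow_mul, ← pow_succ]
      exact hm
  rw [← conjTranspose_mul_self_eq_zero]
  apply hH N
  rw [hB.mul_pow, ← Nat.sub_add_cancel (Nat.lt_two_pow_self (n := N)).le, pow_add B, hN]
  simp

theorem groverMatrix_pow_eq_one_of_nilpotent (h : G.IsRegularOfDegree k) (hk : k ≠ 0) {p N : ℕ}
    (hN : (G.groverMatrix ^ p - 1) ^ N = 0) : G.groverMatrix ^ p = 1 := by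
  have h1 := h.conjTranspose_groverMatrix_mul_self hk
  have h2 : Commute G.groverMatrixᴴ G.groverMatrix := by
    rw [Commute, SemiconjBy, h1, mul_eq_one_comm.1 h1]
  refine sub_eq_zero.1 (eq_zero_of_star_mul_self_eq_zero_of_pow ?_ hN)
  rw [conjTranspose_sub, conjTranspose_pow, conjTranspose_one]
  exact ((h2.pow_pow p p).sub_left (Commute.one_left _)).sub_right
    ((Commute.one_right _))

/-- A cubic equation for twice the transition matrix gives an equation for the Grover matrix. -/
theorem IsRegularOfDegree.aeval_groverMatrix_eq_zero (h : G.IsRegularOfDegree k) (hk : k ≠ 0)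
    {a b c : ℂ} {Q : Matrix V V ℂ} (hQ : Q = (2 / k : ℂ) • G.adjMatrix ℂ)
    (hcub : Q * (Q * Q) + a • (Q * Q) + b • Q + c • 1 = 0) :
    aeval G.groverMatrix (((X ^ 2 + 1) ^ 3 + C a * (X * (X ^ 2 + 1) ^ 2)
      + C b * (X ^ 2 * (X ^ 2 + 1)) + C c * X ^ 3) * (X ^ 2 - 1) : ℂ[X]) = 0 := by
  set U := G.groverMatrix with hU
  set T := G.terminusMatrix
  have e1 : (U ^ 2 + 1) * T = U * (T * Q) := by
    rw [hQ, ← Matrix.mul_assoc, hU, h.groverMatrix_sq_add_one_mul hk]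
  have hc : ∀ m : ℕ, Commute (U ^ 2 + 1) (U ^ m) := fun m =>
    ((Commute.pow_pow_self U 2 m)).add_left (Commute.one_left _)
  have e2 : (U ^ 2 + 1) ^ 2 * T = U ^ 2 * (T * (Q * Q)) := by
    rw [pow_two (U ^ 2 + 1), Matrix.mul_assoc, e1, ← Matrix.mul_assoc,
      (by simpa using (hc 1).eq : (U ^ 2 + 1) * U = U * (U ^ 2 + 1)),
      Matrix.mul_assoc, ← Matrix.mul_assoc _ T, e1, pow_two]
    simp only [Matrix.mul_assoc]
  have e3 : (U ^ 2 + 1) ^ 3 * T = U ^ 3 * (T * (Q * (Q * Q))) := by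
    rw [pow_succ' _ 2, Matrix.mul_assoc, e2, ← Matrix.mul_assoc, (hc 2).eq,
      Matrix.mul_assoc, ← Matrix.mul_assoc _ T, e1, pow_succ U 2]
    simp only [Matrix.mul_assoc]
  -- The cubic of `Q` evaluated at `X + X⁻¹`, cleared of denominators by `X ^ 3`.
  set q : ℂ[X] := (X ^ 2 + 1) ^ 3 + C a * (X * (X ^ 2 + 1) ^ 2)
      + C b * (X ^ 2 * (X ^ 2 + 1)) + C c * X ^ 3 with hq
  have hqU : aeval U q = (U ^ 2 + 1) ^ 3 + a • (U * (U ^ 2 + 1) ^ 2)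
      + b • (U ^ 2 * (U ^ 2 + 1)) + c • U ^ 3 := by
    simp [hq, Algebra.algebraMap_eq_smul_one]
  have hqT : aeval U q * T = 0 := by
    have : aeval U q * T = U ^ 3 * (T * (Q * (Q * Q) + a • (Q * Q) + b • Q + c • 1)) := by
      rw [hqU, Matrix.add_mul, Matrix.add_mul, Matrix.add_mul, Matrix.smul_mul, Matrix.smul_mul,
        Matrix.smul_mul, Matrix.mul_assoc, Matrix.mul_assoc, e1, e2, e3]
      simp only [Matrix.mul_add, Matrix.mul_smul, Matrix.mul_one]
      simp only [← Matrix.mul_assoc, (pow_succ' U 2).symm, (pow_succ U 2).symm, Nat.reduceAdd]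
    rw [this, hcub, Matrix.mul_zero, Matrix.mul_zero]
  have hcomm : aeval U q * U = U * aeval U q := by
    simpa using congrArg (aeval U) (mul_comm q X)
  have hqUT : aeval U q * (U * T) = 0 := by
    rw [← Matrix.mul_assoc, hcomm, Matrix.mul_assoc, hqT, Matrix.mul_zero]
  have hqUUT : aeval U q * (U * (U * T)) = 0 := by
    rw [← Matrix.mul_assoc, hcomm, Matrix.mul_assoc, hqUT, Matrix.mul_zero]
  have h5 := h.groverMatrix_sq_sub_one hk
  rw [map_mul]
  have h6 : aeval U (X ^ 2 - 1 : ℂ[X]) = U ^ 2 - 1 := by simp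
  rw [h6, h5, Matrix.mul_smul, Matrix.mul_sub, ← Matrix.mul_assoc (aeval U q) (U * (U * T)),
    ← Matrix.mul_assoc (aeval U q) (U * T), hqUUT, hqUT, Matrix.zero_mul, Matrix.zero_mul, sub_zero,
    smul_zero]

theorem IsRegularOfDegree.groverMatrix_pow_eq_one_of_dvd (h : G.IsRegularOfDegree k) (hk : k ≠ 0)
    {a b c : ℂ} {Q : Matrix V V ℂ} (hQ : Q = (2 / k : ℂ) • G.adjMatrix ℂ)
    (hcub : Q * (Q * Q) + a • (Q * Q) + b • Q + c • 1 = 0) {p N : ℕ}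
    (hdvd : ((X ^ 2 + 1) ^ 3 + C a * (X * (X ^ 2 + 1) ^ 2)
      + C b * (X ^ 2 * (X ^ 2 + 1)) + C c * X ^ 3) * (X ^ 2 - 1) ∣ ((X ^ p - 1) ^ N : ℂ[X])) :
    G.groverMatrix ^ p = 1 := by
  obtain ⟨g, hg⟩ := hdvd
  have h1 := congrArg (aeval G.groverMatrix) hg
  rw [map_mul, h.aeval_groverMatrix_eq_zero hk hQ hcub, zero_mul] at h1
  exact groverMatrix_pow_eq_one_of_nilpotent h hk (by simpa using h1)

theorem IsSRGWith.groverMatrix_pow_four_eq_one {n : ℕ} (h : G.IsSRGWith n k 0 k) (hk : k ≠ 0) :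
    G.groverMatrix ^ 4 = 1 := by
  have hk' : (k : ℂ) ≠ 0 := Nat.cast_ne_zero.2 hk
  -- `Q` has cubic `x(x - 2)(x + 2)`, so the annihilator is `(X² + 1)(X² - 1)³`.
  refine h.regular.groverMatrix_pow_eq_one_of_dvd hk (a := 0) (b := -4) (c := 0) (N := 3) rfl ?_ ?_
  · simp only [Matrix.smul_mul, Matrix.mul_smul, h.adjMatrix_cubic]
    match_scalars <;> field_simp <;> ring
  · refine ⟨(X ^ 2 + 1) ^ 2, ?_⟩
    simp only [map_neg, map_zero, map_ofNat]
    ring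

theorem IsSRGWith.groverMatrix_pow_twelve_eq_one {n m : ℕ} (h : G.IsSRGWith n (2 * m) m (2 * m))
    (hm : m ≠ 0) : G.groverMatrix ^ 12 = 1 := by
  have hm' : (m : ℂ) ≠ 0 := Nat.cast_ne_zero.2 hm
  -- The cubic is `x(x - 2)(x + 1)`. Its roots contribute `X² + 1`, `(X - 1)²` and `X² + X + 1`, and
  -- `X² - 1` comes on top: roots of unity of order dividing 12.
  refine h.regular.groverMatrix_pow_eq_one_of_dvd (by omega) (a := -1) (b := -2) (c := 0) (N := 3)
    rfl ?_ ?_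
  · simp only [Matrix.smul_mul, Matrix.mul_smul, h.adjMatrix_cubic]
    match_scalars <;> field_simp <;> ring
  · refine ⟨(X ^ 2 + X + 1) ^ 2 * (X + 1) ^ 2 * (X ^ 2 + 1) ^ 2 * (X ^ 2 - X + 1) ^ 3
      * (X ^ 4 - X ^ 2 + 1) ^ 3, ?_⟩
    simp only [map_neg, map_zero, map_ofNat, map_one]
    ring

theorem IsSRGWith.groverMatrix_pow_ten_eq_one {n : ℕ} (h : G.IsSRGWith n 2 0 1) :
    G.groverMatrix ^ 10 = 1 := by
  -- Here `Q = A` with cubic `(x - 2)(x² + x - 1)`. The quadratic contributes the fifth cyclotomic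
  -- polynomial, and the extra `X² - 1` turns 5 into 10.
  refine h.regular.groverMatrix_pow_eq_one_of_dvd two_ne_zero (a := -1) (b := -3) (c := 2) (N := 3)
    rfl ?_ ?_
  · simp only [Matrix.smul_mul, Matrix.mul_smul, h.adjMatrix_cubic]
    match_scalars <;> norm_num
  · refine ⟨(X ^ 4 + X ^ 3 + X ^ 2 + X + 1) ^ 2 * (X + 1) ^ 2 * (X ^ 4 - X ^ 3 + X ^ 2 - X + 1) ^ 3,
      ?_⟩
    simp only [map_neg, map_ofNat, map_one]
    ring

end Converse

end SimpleGraph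

namespace SimpleGraph

set_option linter.unusedSectionVars false

/-! ### Distance-regular of diameter 2 versus strongly regular -/

section DistanceRegular

variable {V : Type*} [Fintype V] [DecidableEq V] {G : SimpleGraph V} [DecidableRel G.Adj]
variable {n k ℓ μ : ℕ}

theorem dist_cases_of_diam_eq_two (h : G.diam = 2) (x y : V) :
    (x = y ∧ G.dist x y = 0) ∨ (G.Adj x y ∧ G.dist x y = 1) ∨
      (x ≠ y ∧ ¬ G.Adj x y ∧ G.dist x y = 2) := by
  -- An infinite extended diameter would give `diam = 0`, so diameter 2 already entails
  -- connectedness.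
  have hle : G.dist x y ≤ 2 := h ▸ dist_le_diam (ediam_ne_top_of_diam_ne_zero (by omega))
  have : Nonempty V := ⟨x⟩
  have hc : G.Connected := connected_of_ediam_ne_top (ediam_ne_top_of_diam_ne_zero (by omega))
  by_cases hxy : x = y
  · exact Or.inl ⟨hxy, by simp [hxy]⟩
  · by_cases ha : G.Adj x y
    · exact Or.inr (Or.inl ⟨ha, dist_eq_one_iff_adj.2 ha⟩)
    · exact Or.inr (Or.inr ⟨hxy, ha, le_antisymm hle (hc.one_lt_dist_of_ne_of_not_adj hxy ha)⟩)

theorem card_commonNeighbors_eq_card_filter (x y : V) :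
    Fintype.card (G.commonNeighbors x y) = ((G.neighborFinset y).filter fun z => G.Adj x z).card := by
  rw [← Set.toFinset_card]
  congr 1
  ext z
  simp [mem_commonNeighbors, and_comm]

theorem IsDistanceRegular.exists_isSRGWith (h : G.IsDistanceRegular) (hd : G.diam = 2) :
    ∃ n k ℓ μ : ℕ, G.IsSRGWith n k ℓ μ := by
  obtain ⟨k, hk⟩ := h.regular
  obtain ⟨c, a, b, hcab⟩ := h.intersection
  refine ⟨_, k, a 1, c 2, rfl, hk, fun x y hxy => ?_, fun x y hne hxy => ?_⟩
  · rw [← (hcab 1 x y (dist_eq_one_iff_adj.2 hxy)).2.1, card_commonNeighbors_eq_card_filter]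
    simp only [dist_eq_one_iff_adj]
  · have h2 : G.dist x y = 2 := by
      rcases dist_cases_of_diam_eq_two hd x y with h | h | h
      · exact absurd h.1 hne
      · exact absurd h.1 hxy
      · exact h.2.2
    rw [← (hcab 2 x y h2).1, card_commonNeighbors_eq_card_filter]
    simp only [Nat.reduceEqDiff, dist_eq_one_iff_adj]

theorem exists_not_adj_of_diam_eq_two (hd : G.diam = 2) :
    ∃ x y z : V, x ≠ y ∧ ¬ G.Adj x y ∧ G.Adj x z ∧ G.Adj y z := by
  have hn : Nontrivial V := nontrivial_of_diam_ne_zero (by omega : G.diam ≠ 0)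
  obtain ⟨x, y, hxy⟩ := G.exists_dist_eq_diam
  have he : G.edist x y = 2 := by
    have h0 : G.dist x y ≠ 0 := by omega
    have hr : G.Reachable x y := by
      by_contra hr
      exact h0 (dist_eq_zero_of_not_reachable hr)
    rw [← hr.coe_dist_eq_edist, hxy, hd]
    rfl
  obtain ⟨h1, h2, z, hz⟩ := edist_eq_two_iff.1 he
  exact ⟨x, y, z, h1, h2, hz⟩

theorem IsSRGWith.param_bounds (h : G.IsSRGWith n k ℓ μ) {x y z : V} (hxy : x ≠ y)
    (hadj : ¬ G.Adj x y) (hxz : G.Adj x z) (hyz : G.Adj y z) : μ ≠ 0 ∧ μ ≤ k ∧ ℓ + 2 ≤ k := by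
  have h1 := h.of_not_adj hxy hadj
  have h2 := h.of_adj _ _ hxz
  rw [card_commonNeighbors_eq_card_filter] at h1 h2
  refine ⟨?_, ?_, ?_⟩
  · rw [← h1]
    exact Finset.card_ne_zero_of_mem (a := z) (by simp [hxz, hyz])
  · rw [← h1, ← h.regular y]
    exact Finset.card_filter_le _ _
  · rw [← h2, ← h.regular z]
    -- Besides the `ℓ` common neighbours of `x` and `z`, the vertex `z` has the neighbours `x` and
    -- `y`.
    have hsub : insert x (insert y ((G.neighborFinset z).filter fun w => G.Adj x w)) ⊆
        G.neighborFinset z := by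
      intro w hw
      simp only [Finset.mem_insert, Finset.mem_filter, mem_neighborFinset] at hw ⊢
      rcases hw with rfl | rfl | hw
      · exact hxz.symm
      · exact hyz.symm
      · exact hw.1
    have := Finset.card_le_card hsub
    rw [Finset.card_insert_of_notMem (by simp [hxy]),
      Finset.card_insert_of_notMem (by simp [hadj])] at this
    exact this

theorem card_filter_dist_add (x y : V) :
    ((G.neighborFinset y).filter fun z => G.dist x z + 1 = G.dist x y).card +
      ((G.neighborFinset y).filter fun z => G.dist x z = G.dist x y).card +
      ((G.neighborFinset y).filter fun z => G.dist x z = G.dist x y + 1).card = G.degree y := by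
  rw [← card_neighborFinset_eq_degree, ← Finset.card_union_of_disjoint, ←
    Finset.card_union_of_disjoint]
  · congr 1
    ext z
    simp only [Finset.mem_union, Finset.mem_filter, mem_neighborFinset]
    constructor
    · tauto
    · intro hz
      have := hz.diff_dist_adj (u := x)
      by_cases h0 : G.dist x y = 0
      · rcases this with h | h | h <;> simp [hz] <;> omega
      · rcases this with h | h | h <;> simp [hz] <;> omega
  · rw [Finset.disjoint_left]
    intro z
    simp only [Finset.mem_union, Finset.mem_filter]
    omega
  · rw [Finset.disjoint_left]
    intro z
    simp only [Finset.mem_filter]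
    omega

theorem IsSRGWith.isDistanceRegular (h : G.IsSRGWith n k ℓ μ) (hμ : μ ≠ 0) {x y : V}
    (hxy : x ≠ y) (hadj : ¬ G.Adj x y) : G.IsDistanceRegular ∧ G.diam = 2 := by
  have hn : Nontrivial V := ⟨x, y, hxy⟩
  have he : G.ediam = 2 := h.ediam_eq_two (by rintro rfl; exact hadj hxy) hμ
  have hd : G.diam = 2 := by rw [diam, he]; rfl
  refine ⟨⟨connected_of_ediam_ne_top (by simp [he]), ⟨k, h.regular⟩, ?_⟩, hd⟩
  -- Distances above 2 do not occur, so the values for `j ≥ 3` are arbitrary. At each distance two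
  -- of the numbers are counted directly and the third follows from the degree.
  refine ⟨fun j => if j = 0 then 0 else if j = 1 then 1 else μ,
    fun j => if j = 0 then 0 else if j = 1 then ℓ else k - μ,
    fun j => if j = 0 then k else if j = 1 then k - 1 - ℓ else 0, ?_⟩
  rintro j x y rfl
  have hsum := card_filter_dist_add (G := G) x y
  rw [h.regular y] at hsum
  rcases dist_cases_of_diam_eq_two hd x y with ⟨hxy, h0⟩ | ⟨hxy, h0⟩ | ⟨hne, hxy, h0⟩
  · subst hxy
    have ha : ((G.neighborFinset x).filter fun z => G.dist x z = G.dist x x) = ∅ := by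
      ext z
      simp only [Finset.mem_filter, mem_neighborFinset, h0, Finset.notMem_empty, iff_false, not_and]
      intro hz
      rw [dist_eq_one_iff_adj.2 hz]
      omega
    have hc : ((G.neighborFinset x).filter fun z => G.dist x z + 1 = G.dist x x) = ∅ := by
      ext z
      simp
    rw [ha, hc] at hsum ⊢
    simp only [Finset.card_empty] at hsum ⊢
    simp only [h0] at hsum ⊢
    simpa using hsum
  · have hc : ((G.neighborFinset y).filter fun z => G.dist x z + 1 = G.dist x y) = {x} := by
      ext z
      simp only [Finset.mem_filter, mem_neighborFinset, h0, Finset.mem_singleton]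
      constructor
      · rintro ⟨-, hz⟩
        rcases dist_cases_of_diam_eq_two hd x z with h | h | h
        · exact h.1.symm
        · omega
        · omega
      · rintro rfl
        exact ⟨hxy.symm, by simp⟩
    have ha : ((G.neighborFinset y).filter fun z => G.dist x z = G.dist x y).card = ℓ := by
      rw [← h.of_adj x y hxy, card_commonNeighbors_eq_card_filter]
      simp only [h0, dist_eq_one_iff_adj]
    rw [hc, ha] at hsum ⊢
    simp only [Finset.card_singleton] at hsum ⊢
    simp only [h0] at hsum ⊢
    refine ⟨rfl, rfl, ?_⟩
    simp only [one_ne_zero, if_false, if_true]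
    omega
  · have hb : ((G.neighborFinset y).filter fun z => G.dist x z = G.dist x y + 1) = ∅ := by
      ext z
      simp only [Finset.mem_filter, h0, Finset.notMem_empty, iff_false, not_and]
      intro _
      rcases dist_cases_of_diam_eq_two hd x z with h | h | h <;> omega
    have hc : ((G.neighborFinset y).filter fun z => G.dist x z + 1 = G.dist x y).card = μ := by
      rw [← h.of_not_adj hne hxy, card_commonNeighbors_eq_card_filter]
      simp only [h0, Nat.reduceEqDiff, dist_eq_one_iff_adj]
    rw [hc, hb] at hsum ⊢
    simp only [Finset.card_empty] at hsum ⊢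
    simp only [h0] at hsum ⊢
    refine ⟨rfl, ?_, rfl⟩
    simp only [OfNat.ofNat_ne_zero, OfNat.ofNat_ne_one, if_false]
    omega

end DistanceRegular

/-! ### Complete multipartite graphs with equal parts -/

section Multipartite

variable {V : Type*} [Fintype V] [DecidableEq V] {G : SimpleGraph V} [DecidableRel G.Adj]

/-- `f` exhibits `G` as a complete multipartite graph with parts of size `m`. -/
structure IsEquipartition {ι : Type*} [DecidableEq ι] (G : SimpleGraph V) (m : ℕ) (f : V → ι) :
    Prop where
  adj_iff : ∀ x y, G.Adj x y ↔ f x ≠ f y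
  card_fiber : ∀ i, (Finset.univ.filter fun x => f x = i).card = m

variable {ι : Type*} [Fintype ι] [DecidableEq ι] {m : ℕ} {f : V → ι}

theorem IsEquipartition.card (h : IsEquipartition G m f) :
    Fintype.card V = Fintype.card ι * m := by
  rw [← Finset.card_univ, Finset.card_eq_sum_card_fiberwise (f := f) (t := Finset.univ) (by simp)]
  simp [h.card_fiber]

theorem IsEquipartition.card_filter_ne (h : IsEquipartition G m f) (i : ι) :
    (Finset.univ.filter fun x => f x ≠ i).card = (Fintype.card ι - 1) * m := by
  have := Finset.card_filter_add_card_filter_not (s := (Finset.univ : Finset V)) (fun x => f x = i)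
  rw [h.card_fiber, Finset.card_univ, h.card] at this
  rw [Nat.sub_mul, one_mul]
  simp only [ne_eq]
  omega

theorem IsEquipartition.card_filter_ne_ne (h : IsEquipartition G m f) {i j : ι} (hij : i ≠ j) :
    (Finset.univ.filter fun x => f x ≠ i ∧ f x ≠ j).card = (Fintype.card ι - 2) * m := by
  have h1 := Finset.card_filter_add_card_filter_not
    (s := Finset.univ.filter fun x => f x ≠ i) (fun x => f x = j)
  rw [h.card_filter_ne, Finset.filter_filter, Finset.filter_filter] at h1
  have h2 : (Finset.univ.filter fun x => f x ≠ i ∧ f x = j) =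
      Finset.univ.filter fun x => f x = j := by
    ext x
    simp only [Finset.mem_filter, Finset.mem_univ, true_and, and_iff_right_iff_imp]
    rintro rfl
    exact hij.symm
  rw [h2, h.card_fiber] at h1
  rw [show Fintype.card ι - 2 = Fintype.card ι - 1 - 1 by omega, Nat.sub_mul _ 1, one_mul]
  simp only [ne_eq] at h1 ⊢
  omega

theorem IsEquipartition.isSRGWith (h : IsEquipartition G m f) :
    G.IsSRGWith (Fintype.card ι * m) ((Fintype.card ι - 1) * m) ((Fintype.card ι - 2) * m)
      ((Fintype.card ι - 1) * m) where
  card := h.card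
  regular x := by
    rw [← card_neighborFinset_eq_degree, ← h.card_filter_ne (f x)]
    congr 1
    ext y
    simp [h.adj_iff, eq_comm]
  of_adj x y hxy := by
    rw [card_commonNeighbors_eq_card_filter, ← h.card_filter_ne_ne ((h.adj_iff x y).1 hxy)]
    congr 1
    ext z
    simp only [h.adj_iff, Finset.mem_filter, mem_neighborFinset, Finset.mem_univ, true_and]
    tauto
  of_not_adj x y _ hxy := by
    rw [card_commonNeighbors_eq_card_filter, ← h.card_filter_ne (f x)]
    congr 1
    ext z
    have : f x = f y := by simpa [h.adj_iff] using hxy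
    simp only [h.adj_iff, Finset.mem_filter, mem_neighborFinset, Finset.mem_univ, true_and, this]
    tauto

theorem IsEquipartition.nonempty_iso (h : IsEquipartition G m f) :
    Nonempty (G ≃g completeMultipartiteGraph (fun _ : ι => Fin m)) := by
  have e : ∀ i, Nonempty ({x // f x = i} ≃ Fin m) := fun i =>
    ⟨Fintype.equivFinOfCardEq (by rw [Fintype.card_subtype, h.card_fiber])⟩
  refine ⟨⟨(Equiv.sigmaFiberEquiv f).symm.trans (Equiv.sigmaCongrRight fun i => (e i).some), ?_⟩⟩
  intro x y
  simp [h.adj_iff, Equiv.sigmaFiberEquiv]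

theorem isEquipartition_of_iso (φ : G ≃g completeMultipartiteGraph (fun _ : ι => Fin m)) :
    IsEquipartition G m fun x => (φ x).1 where
  adj_iff x y := by rw [← φ.map_adj_iff]; simp
  card_fiber i := by
    rw [← Fintype.card_subtype]
    refine Eq.trans ?_ (Fintype.card_fin m)
    refine Fintype.card_congr ((φ.toEquiv.subtypeEquiv (q := fun p => p.1 = i) ?_).trans
      (Equiv.sigmaSubtype i))
    intro x
    rfl

/-- When `μ = k`, non-adjacent vertices have equal neighbourhoods, so non-adjacency is an
equivalence relation. Each class consists of the `n - k` non-neighbours of a vertex, itself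
included, and `ht` fixes the number of classes. -/
theorem IsSRGWith.exists_isEquipartition {n k ℓ t : ℕ} (h : G.IsSRGWith n k ℓ k) (hkn : k < n)
    (ht : n = t * (n - k)) : ∃ f : V → Fin t, IsEquipartition G (n - k) f := by
  have hN : ∀ x y, ¬ G.Adj x y → ∀ z, G.Adj y z → G.Adj x z := by
    intro x y hxy z hz
    by_cases hne : x = y
    · exact hne ▸ hz
    have h1 := h.of_not_adj hne hxy
    rw [card_commonNeighbors_eq_card_filter] at h1
    have h2 := Finset.eq_of_subset_of_card_le (Finset.filter_subset (fun z => G.Adj x z)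
      (G.neighborFinset y)) (by rw [h1, card_neighborFinset_eq_degree, h.regular y])
    have h3 : z ∈ (G.neighborFinset y).filter fun z => G.Adj x z := by rw [h2]; simpa using hz
    exact (Finset.mem_filter.1 h3).2
  have hG : G.IsCompleteMultipartite := ⟨fun x y z hxy hyz hxz =>
    hyz (hN y x (fun h' => hxy h'.symm) z hxz)⟩
  classical
  have hadj : ∀ x y, G.Adj x y ↔ (Quotient.mk hG.setoid x) ≠ Quotient.mk hG.setoid y := by
    intro x y
    rw [Ne, Quotient.eq]
    change _ ↔ ¬ ¬ G.Adj x y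
    rw [not_not]
  let _ : Fintype (Quotient hG.setoid) := Fintype.ofFinite _
  have hq : IsEquipartition G (n - k) (Quotient.mk hG.setoid) := by
    refine ⟨hadj, fun i => ?_⟩
    induction i using Quotient.inductionOn with | _ x => ?_
    have h1 := Finset.card_filter_add_card_filter_not (s := (Finset.univ : Finset V))
      (fun y => G.Adj x y)
    have h2 : (Finset.univ.filter fun y => G.Adj x y).card = k := by
      rw [← h.regular x, ← card_neighborFinset_eq_degree]
      congr 1
      ext y
      simp
    rw [h2, Finset.card_univ, h.card] at h1
    rw [← h1, Nat.add_sub_cancel_left]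
    congr 1
    ext y
    simp only [Finset.mem_filter, Finset.mem_univ, true_and, hadj, not_not, eq_comm]
  have hc := hq.card
  rw [h.card] at hc
  have ht' : Fintype.card (Quotient hG.setoid) = t :=
    Nat.eq_of_mul_eq_mul_right (by omega : 0 < n - k) (hc.symm.trans ht)
  let e := Fintype.equivFinOfCardEq ht'
  refine ⟨fun x => e (Quotient.mk _ x), fun x y => ?_, fun i => ?_⟩
  · rw [hadj, e.injective.ne_iff]
  · rw [← hq.card_fiber (e.symm i)]
    congr 1
    ext x
    simp [Equiv.eq_symm_apply]

/-- The complete bipartite graph as a complete multipartite graph. -/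
def completeMultipartiteGraphFinTwoIso (m : ℕ) :
    completeMultipartiteGraph (fun _ : Fin 2 => Fin m) ≃g
      completeBipartiteGraph (Fin m) (Fin m) where
  toFun p := if p.1 = 0 then Sum.inl p.2 else Sum.inr p.2
  invFun := Sum.elim (fun x => ⟨0, x⟩) (fun x => ⟨1, x⟩)
  left_inv := by
    rintro ⟨i, x⟩
    fin_cases i <;> simp
  right_inv := by
    rintro (x | x) <;> simp
  map_rel_iff' := by
    rintro ⟨i, x⟩ ⟨j, y⟩
    fin_cases i <;> fin_cases j <;> simp

end Multipartite

/-! ### Uniqueness of the pentagon -/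

section Pentagon

variable {V : Type*} [Fintype V] [DecidableEq V] {G : SimpleGraph V} [DecidableRel G.Adj]

theorem isSRGWith_of_iso {W : Type*} [Fintype W] [DecidableEq W] {H : SimpleGraph W}
    [DecidableRel H.Adj] {n k ℓ μ : ℕ} (φ : G ≃g H) (h : H.IsSRGWith n k ℓ μ) :
    G.IsSRGWith n k ℓ μ := by
  have hcn : ∀ x y, Fintype.card (G.commonNeighbors x y) =
      Fintype.card (H.commonNeighbors (φ x) (φ y)) := fun x y =>
    Fintype.card_congr (φ.toEquiv.subtypeEquiv fun z => by
      change z ∈ G.commonNeighbors x y ↔ φ z ∈ H.commonNeighbors (φ x) (φ y)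
      rw [mem_commonNeighbors, mem_commonNeighbors, φ.map_adj_iff, φ.map_adj_iff])
  refine ⟨by rw [← h.card]; exact Fintype.card_congr φ.toEquiv, fun x => ?_, fun x y hxy => ?_,
    fun x y hne hxy => ?_⟩
  · rw [← h.regular (φ x), φ.degree_eq]
  · rw [hcn, h.of_adj _ _ (φ.map_adj_iff.2 hxy)]
  · rw [hcn, h.of_not_adj (φ.injective.ne hne) (fun h' => hxy (φ.map_adj_iff.1 h'))]

theorem isSRGWith_cycleGraph_five : (cycleGraph 5).IsSRGWith 5 2 0 1 := by
  refine ⟨by simp, fun x => ?_, fun x y => ?_, fun x y => ?_⟩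
  · revert x; decide
  · revert x y; simp only [card_commonNeighbors_eq_card_filter]; decide
  · revert x y; simp only [card_commonNeighbors_eq_card_filter]; decide

/-- The graph is 2-regular, has no triangle as `ℓ = 0`, and no 4-cycle as `μ = 1`. From `v` with
neighbours `a`, `b`, the further neighbours `c` of `a` and `d` of `b` are new and distinct, and `c`,
`d` must be adjacent to close the cycle. -/
theorem IsSRGWith.nonempty_iso_cycleGraph_five (h : G.IsSRGWith 5 2 0 1) :
    Nonempty (G ≃g cycleGraph 5) := by
  have hV : Fintype.card V = 5 := h.card
  have hnb : ∀ x y : V, G.Adj x y → ∃ z, z ≠ y ∧ ∀ w, G.Adj x w ↔ w = y ∨ w = z := by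
    intro x y hxy
    have h1 : ((G.neighborFinset x).erase y).card = 1 := by
      rw [Finset.card_erase_of_mem (by simpa using hxy), card_neighborFinset_eq_degree, h.regular x]
    obtain ⟨z, hz⟩ := Finset.card_eq_one.1 h1
    have hz' : ∀ w, (w ≠ y ∧ G.Adj x w) ↔ w = z := fun w => by
      rw [← Finset.mem_singleton, ← hz]; simp
    refine ⟨z, ((hz' z).2 rfl).1, fun w => ?_⟩
    have := hz' w
    by_cases hw : w = y
    · simp [hw, hxy]
    · simp [← hz' w, hw]
  have htri : ∀ x y z : V, G.Adj x y → G.Adj x z → ¬ G.Adj y z := by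
    intro x y z hxy hxz hyz
    have h1 := h.of_adj y z hyz
    rw [Fintype.card_eq_zero_iff] at h1
    exact h1.elim ⟨x, hxy.symm, hxz.symm⟩
  have hsq : ∀ x y z w : V, y ≠ z → G.Adj x y → G.Adj x z → G.Adj w y → G.Adj w z → x = w := by
    intro x y z w hyz hxy hxz hwy hwz
    have h1 := h.of_not_adj hyz (htri x y z hxy hxz)
    have h2 := Fintype.card_le_one_iff_subsingleton.1 h1.le
    have h3 := Subsingleton.elim (⟨x, hxy.symm, hxz.symm⟩ : G.commonNeighbors y z)
      ⟨w, hwy.symm, hwz.symm⟩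
    exact congrArg Subtype.val h3
  obtain ⟨v⟩ : Nonempty V := Fintype.card_pos_iff.1 (by omega)
  obtain ⟨a, ha⟩ : (G.neighborFinset v).Nonempty := by
    rw [← Finset.card_pos, card_neighborFinset_eq_degree, h.regular v]; norm_num
  rw [mem_neighborFinset] at ha
  obtain ⟨b, hba, hv⟩ := hnb v a ha
  have hb : G.Adj v b := (hv b).2 (Or.inr rfl)
  obtain ⟨c, hcv, hac⟩ := hnb a v ha.symm
  obtain ⟨d, hdv, hbd⟩ := hnb b v hb.symm
  have hc : G.Adj a c := (hac c).2 (Or.inr rfl)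
  have hd : G.Adj b d := (hbd d).2 (Or.inr rfl)
  have hcd : c ≠ d := by
    rintro rfl
    exact hcv (hsq v a b c hba.symm ha hb hc.symm hd.symm).symm
  have hca : c ≠ a := hc.ne'
  have hcb : c ≠ b := by rintro rfl; exact htri v a c ha hb hc
  have hda : d ≠ a := by rintro rfl; exact htri v b d hb ha hd
  have hdb : d ≠ b := hd.ne'
  have hav := ha.ne'
  have hbv := hb.ne'
  -- The vertices are listed in cyclic order.
  have hinj : Function.Injective ![v, a, c, d, b] := by
    intro i j hij
    fin_cases i <;> fin_cases j <;>
      first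
      | rfl
      | exact (hav hij).elim
      | exact (hav hij.symm).elim
      | exact (hbv hij).elim
      | exact (hbv hij.symm).elim
      | exact (hcv hij).elim
      | exact (hcv hij.symm).elim
      | exact (hdv hij).elim
      | exact (hdv hij.symm).elim
      | exact (hba hij).elim
      | exact (hba hij.symm).elim
      | exact (hca hij).elim
      | exact (hca hij.symm).elim
      | exact (hcb hij).elim
      | exact (hcb hij.symm).elim
      | exact (hda hij).elim
      | exact (hda hij.symm).elim
      | exact (hdb hij).elim
      | exact (hdb hij.symm).elim
      | exact (hcd hij).elim
      | exact (hcd hij.symm).elim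
  have hbij := (Fintype.bijective_iff_injective_and_card ![v, a, c, d, b]).2 ⟨hinj, by simp [hV]⟩
  have hall : ∀ w, w = v ∨ w = a ∨ w = c ∨ w = d ∨ w = b := by
    intro w
    obtain ⟨i, rfl⟩ := hbij.2 w
    fin_cases i <;> simp
  have hvc : ¬ G.Adj v c := by rw [hv]; tauto
  have hvd : ¬ G.Adj v d := by rw [hv]; tauto
  have had : ¬ G.Adj a d := by rw [hac]; tauto
  have hab : ¬ G.Adj a b := by rw [hac]; tauto
  have hbc : ¬ G.Adj b c := by rw [hbd]; tauto
  have hcd' : G.Adj c d := by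
    obtain ⟨e, hea, hce⟩ := hnb c a hc.symm
    have he : G.Adj c e := (hce e).2 (Or.inr rfl)
    rcases hall e with rfl | rfl | rfl | rfl | rfl
    · exact absurd he.symm hvc
    · exact absurd rfl hea
    · exact absurd he (G.irrefl)
    · exact he
    · exact absurd he.symm hbc
  refine ⟨(RelIso.symm ⟨Equiv.ofBijective _ hbij, ?_⟩)⟩
  have hyes : ∀ {x y : V} {i j : Fin 5}, G.Adj x y → (cycleGraph 5).Adj i j →
      (G.Adj x y ↔ (cycleGraph 5).Adj i j) := fun h1 h2 => iff_of_true h1 h2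
  have hno : ∀ {x y : V} {i j : Fin 5}, ¬ G.Adj x y → ¬ (cycleGraph 5).Adj i j →
      (G.Adj x y ↔ (cycleGraph 5).Adj i j) := fun h1 h2 => iff_of_false h1 h2
  have hirr : ∀ x, ¬ G.Adj x x := fun _ => G.irrefl
  have hns : ∀ {x y}, ¬ G.Adj x y → ¬ G.Adj y x := fun h1 h2 => h1 h2.symm
  rintro i j
  fin_cases i <;> fin_cases j
  · exact hno (hirr v) (by decide)
  · exact hyes ha (by decide)
  · exact hno hvc (by decide)
  · exact hno hvd (by decide)
  · exact hyes hb (by decide)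
  · exact hyes ha.symm (by decide)
  · exact hno (hirr a) (by decide)
  · exact hyes hc (by decide)
  · exact hno had (by decide)
  · exact hno hab (by decide)
  · exact hno (hns hvc) (by decide)
  · exact hyes hc.symm (by decide)
  · exact hno (hirr c) (by decide)
  · exact hyes hcd' (by decide)
  · exact hno (hns hbc) (by decide)
  · exact hno (hns hvd) (by decide)
  · exact hno (hns had) (by decide)
  · exact hyes hcd'.symm (by decide)
  · exact hno (hirr d) (by decide)
  · exact hyes hd.symm (by decide)
  · exact hyes hb.symm (by decide)
  · exact hno (hns hab) (by decide)
  · exact hno hbc (by decide)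
  · exact hyes hd (by decide)
  · exact hno (hirr b) (by decide)

end Pentagon

end SimpleGraph

/-! ### Assembling the classification -/

namespace SimpleGraph

variable {V : Type*} [Fintype V] [DecidableEq V] {G : SimpleGraph V} [DecidableRel G.Adj]

theorem IsEquipartition.isDistanceRegular {ι : Type*} [Fintype ι] [DecidableEq ι] {m : ℕ}
    {f : V → ι} (h : IsEquipartition G m f) (hι : 2 ≤ Fintype.card ι) (hm : 2 ≤ m) :
    G.IsDistanceRegular ∧ G.diam = 2 := by
  obtain ⟨i⟩ : Nonempty ι := Fintype.card_pos_iff.1 (by omega)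
  obtain ⟨x, hx, y, hy, hxy⟩ := Finset.one_lt_card.1 (by rw [h.card_fiber i]; omega)
  simp only [Finset.mem_filter, Finset.mem_univ, true_and] at hx hy
  refine h.isSRGWith.isDistanceRegular ?_ hxy ?_
  · exact mul_ne_zero (by omega) (by omega)
  · rw [h.adj_iff, hx, hy]
    simp

theorem IsSRGWith.isDistanceRegular_of_five (h : G.IsSRGWith 5 2 0 1) :
    G.IsDistanceRegular ∧ G.diam = 2 := by
  obtain ⟨φ⟩ := h.nonempty_iso_cycleGraph_five
  refine h.isDistanceRegular one_ne_zero (x := φ.symm 0) (y := φ.symm 2)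
    (φ.symm.injective.ne (by decide)) ?_
  rw [φ.symm.map_adj_iff]
  decide

/-- The count `k(k - ℓ - 1) = (n - k - 1)μ` determines `n`: it is 5, `2k` and `3ℓ` in the three
cases. When `μ = k` the parts have size `n - k`, giving two parts of size `k` or three of size `ℓ`.
-/
theorem IsSRGWith.classification {n k ℓ μ : ℕ} (h : G.IsSRGWith n k ℓ μ) (hℓ : ℓ + 2 ≤ k)
    (hn : 0 < n)
    (hcases : (k = 2 ∧ ℓ = 0 ∧ μ = 1) ∨ (μ = k ∧ ℓ = 0) ∨ (μ = k ∧ 2 * ℓ = k)) :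
    Nonempty (G ≃g cycleGraph 5) ∨
      (∃ k : ℕ, 2 ≤ k ∧ Nonempty (G ≃g completeBipartiteGraph (Fin k) (Fin k))) ∨
      (∃ m : ℕ, 2 ≤ m ∧ Nonempty (G ≃g completeMultipartiteGraph (fun _ : Fin 3 => Fin m))) := by
  have hpar := IsSRGWith.param_eq G h hn
  rcases hcases with ⟨rfl, rfl, rfl⟩ | ⟨rfl, rfl⟩ | ⟨rfl, rfl⟩
  · left
    obtain rfl : n = 5 := by omega
    exact h.nonempty_iso_cycleGraph_five
  · right; left
    rw [mul_comm (n - μ - 1)] at hpar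
    have := Nat.eq_of_mul_eq_mul_left (by omega) hpar
    obtain ⟨f, hf⟩ := h.exists_isEquipartition (t := 2) (by omega) (by omega)
    obtain ⟨φ⟩ := hf.nonempty_iso
    exact ⟨_, by omega, ⟨φ.trans (completeMultipartiteGraphFinTwoIso _)⟩⟩
  · right; right
    rw [mul_comm (n - 2 * ℓ - 1)] at hpar
    have := Nat.eq_of_mul_eq_mul_left (by omega) hpar
    obtain ⟨f, hf⟩ := h.exists_isEquipartition (t := 3) (by omega) (by omega)
    exact ⟨_, by omega, hf.nonempty_iso⟩

end SimpleGraph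

open SimpleGraph in
theorem theorem4p3 {V : Type*} [Fintype V] [DecidableEq V] (G : SimpleGraph V)
    [DecidableRel G.Adj] :
    (G.IsDistanceRegular ∧ G.diam = 2 ∧ G.IsGroverPeriodic) ↔
      (Nonempty (G ≃g SimpleGraph.cycleGraph 5) ∨
        (∃ k : ℕ, 2 ≤ k ∧ Nonempty (G ≃g completeBipartiteGraph (Fin k) (Fin k))) ∨
        (∃ m : ℕ, 2 ≤ m ∧ Nonempty
          (G ≃g SimpleGraph.completeMultipartiteGraph (fun _ : Fin 3 => Fin m)))) := by
  rw [isGroverPeriodic_iff_exists_pow_eq_one]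
  constructor
  · rintro ⟨hG, hd, p, hp, hU⟩
    obtain ⟨n, k, ℓ, μ, h⟩ := hG.exists_isSRGWith hd
    obtain ⟨x, y, z, hxy, hadj, hxz, hyz⟩ := exists_not_adj_of_diam_eq_two hd
    obtain ⟨hμ, hμk, hℓ⟩ := h.param_bounds hxy hadj hxz hyz
    have hn : 0 < n := h.card ▸ Fintype.card_pos_iff.2 ⟨x⟩
    exact h.classification hℓ hn
      (h.params_of_groverMatrix_pow_eq_one hμ hμk hℓ hxy hadj hp hU)
  · rintro (⟨⟨φ⟩⟩ | ⟨k, hk, ⟨φ⟩⟩ | ⟨m, hm, ⟨φ⟩⟩)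
    · have h := isSRGWith_of_iso φ isSRGWith_cycleGraph_five
      obtain ⟨h1, h2⟩ := h.isDistanceRegular_of_five
      exact ⟨h1, h2, 10, by norm_num, h.groverMatrix_pow_ten_eq_one⟩
    · have hf := isEquipartition_of_iso (φ.trans (completeMultipartiteGraphFinTwoIso k).symm)
      obtain ⟨h1, h2⟩ := hf.isDistanceRegular (by simp) hk
      have h := hf.isSRGWith
      simp only [Fintype.card_fin, Nat.add_one_sub_one, one_mul, Nat.sub_self, zero_mul] at h
      exact ⟨h1, h2, 4, by norm_num, h.groverMatrix_pow_four_eq_one (by omega)⟩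
    · have hf := isEquipartition_of_iso φ
      obtain ⟨h1, h2⟩ := hf.isDistanceRegular (by simp) hm
      have h := hf.isSRGWith
      simp only [Fintype.card_fin, Nat.reduceSub, one_mul] at h
      exact ⟨h1, h2, 12, by norm_num, h.groverMatrix_pow_twelve_eq_one (by omega)⟩
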